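/- Let $g\ge 0$ be an integer. (a) Let $\mathbb R\langle x\rangle$ be the free algebra over $\mathbb R$ in noncommuting variables $x=(x_1,\dots,x_g)$, with the $\mathbb R$-linear involution ${}^*$ determined by $x_j^*=x_j$ and $(fq)^*=q^*f^*$. Let $p\in\mathbb R\langle x\rangle$ be symmetric ($p^*=p$) and matrix convex, that is, for every positive integer $n$, all $g$-tuples $X=(X_1,\dots,X_g)$, $Y=(Y_1,\dots,Y_g)$ of real symmetric $n\times n$ matrices and all $0\le t\le 1$, $$p(tX+(1-t)Y)\ \le\ t\,p(X)+(1-t)\,p(Y),$$ where $A\le B$ means that $B-A$ is positive semidefinite. Then $p$ has degree at most two. (b) Let $\mathbb R\langle x,x^*\rangle$ be the free algebra over $\mathbb R$ in noncommuting variables $x_1,\dots,x_g,x_1^*,\dots,x_g^*$, with the $\mathbb R$-linear involution determined by $x_j\mapsto x_j^*$, $x_j^*\mapsto x_j$ and $(fq)^*=q^*f^*$. Let $p\in\mathbb R\langle x,x^*\rangle$ be symmetric ($p^*=p$) and matrix convex, that is, for every positive integer $n$, all $g$-tuples $X,Y$ of (arbitrary) real $n\times n$ matrices and all $0\le t\le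 1$, $$p\bigl(tX+(1-t)Y,\,(tX+(1-t)Y)^{T}\bigr)\ \le\ t\,p(X,X^{T})+(1-t)\,p(Y,Y^{T}),$$ where $x_j^*$ is evaluated at the transpose $X_j^T$. Then $p$ has degree at most two. Here the degree of a polynomial is the maximal length of a word occurring in it with nonzero coefficient (the zero polynomial has degree $-\infty$). -/

import Mathlib

namespace NCPoly

/-- The degree of a polynomial in freely noncommuting variables indexed by `σ`: the maximal length
of a word occurring with nonzero coefficient (and `⊥` for the zero polynomial). -/
noncomputable def degree {σ : Type*} (p : FreeAlgebra ℝ σ) : WithBot ℕ :=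
  (FreeAlgebra.equivMonoidAlgebraFreeMonoid p).coeff.support.sup
    fun w : FreeMonoid σ => (w.length : WithBot ℕ)

/-! ### Symmetric variables: the algebra `ℝ⟨x⟩`

`ℝ⟨x⟩` is `FreeAlgebra ℝ (Fin g)`. Its involution is Mathlib's `star`, which fixes the generators
and the scalars and reverses words. -/

/-- The value `p(X)` of `p ∈ ℝ⟨x⟩` at a tuple `X` of square matrices. -/
noncomputable def eval {g n : ℕ} (X : Fin g → Matrix (Fin n) (Fin n) ℝ)
    (p : FreeAlgebra ℝ (Fin g)) : Matrix (Fin n) (Fin n) ℝ :=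
  FreeAlgebra.lift ℝ X p

/-- Matrix convexity of `p ∈ ℝ⟨x⟩`: `p(tX + (1-t)Y) ≤ t p(X) + (1-t) p(Y)` for all tuples of real
symmetric matrices of every positive size. -/
def MatrixConvex {g : ℕ} (p : FreeAlgebra ℝ (Fin g)) : Prop :=
  ∀ n : ℕ, 0 < n → ∀ X Y : Fin g → Matrix (Fin n) (Fin n) ℝ,
    (∀ i, (X i).IsSymm) → (∀ i, (Y i).IsSymm) → ∀ t : ℝ, 0 ≤ t → t ≤ 1 →
      (t • eval X p + (1 - t) • eval Y p - eval (t • X + (1 - t) • Y) p).PosSemidef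

/-! ### Free variables: the algebra `ℝ⟨x, x*⟩`

`ℝ⟨x, x*⟩` is `FreeAlgebra ℝ (Fin g ⊕ Fin g)`, where `Sum.inl j` stands for `x_j` and `Sum.inr j`
for `x_j*`. -/

/-- The involution of `ℝ⟨x, x*⟩`: it exchanges `x_j` and `x_j*`, fixes the scalars and reverses
words. -/
noncomputable def adjoint {g : ℕ} (p : FreeAlgebra ℝ (Fin g ⊕ Fin g)) :
    FreeAlgebra ℝ (Fin g ⊕ Fin g) :=
  star (FreeAlgebra.lift ℝ (fun s : Fin g ⊕ Fin g => FreeAlgebra.ι ℝ s.swap) p)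

/-- The value `p(X, X*)` of `p ∈ ℝ⟨x, x*⟩` at a tuple `X` of square matrices: `x_j` is replaced by
`X_j` and `x_j*` by the transpose of `X_j`. -/
noncomputable def evalStar {g n : ℕ} (X : Fin g → Matrix (Fin n) (Fin n) ℝ)
    (p : FreeAlgebra ℝ (Fin g ⊕ Fin g)) : Matrix (Fin n) (Fin n) ℝ :=
  FreeAlgebra.lift ℝ (Sum.elim X fun j => (X j).transpose) p

/-- Matrix convexity of `p ∈ ℝ⟨x, x*⟩`: the convexity inequality for all tuples of real square
matrices (not necessarily symmetric) of every positive size. -/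
def MatrixConvexStar {g : ℕ} (p : FreeAlgebra ℝ (Fin g ⊕ Fin g)) : Prop :=
  ∀ n : ℕ, 0 < n → ∀ X Y : Fin g → Matrix (Fin n) (Fin n) ℝ, ∀ t : ℝ, 0 ≤ t → t ≤ 1 →
    (t • evalStar X p + (1 - t) • evalStar Y p - evalStar (t • X + (1 - t) • Y) p).PosSemidef

end NCPoly

namespace NCPoly

variable {σ : Type*}

/-! ### Expansion of a free polynomial in words -/

/-! Suppose a longest word `v` of `p` has length d ≥ 3. Label a d-cycle by `v`, an edge crossed
backwards reading `τ` of its letter; give edge 0 weight e, edge 1 weight 1, the rest weight 1. The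
(0,0) entry q(e) of the value of `p` counts weighted closed walks at vertex 0. Flipping the signs of
both special weights is conjugation by a diagonal sign at vertex 1, so q is unchanged
(`walkWeight_neg`), while the midpoint has both edges cut. A walk using edge 1 but not edge 0 needs
length at least 2(d-1) > d, so the midpoint entry is q(0) (`walkWeight_congr`), and convexity gives
q(0) ≤ q(e). Hence q'(0) = 0. But q'(0) counts walks crossing edge 0 once; with length at most d
they run once round the cycle and read `v` or its adjoint (`walkDeriv_zero_of_length_eq`). By
symmetry q'(0) is twice the coefficient of `v`, which is nonzero. Taking `τ` to be `id` or
`Sum.swap` gives the two cases. -/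

/-- The coefficient of the word `u` in `p`. -/
noncomputable def wordCoeff (p : FreeAlgebra ℝ σ) (u : FreeMonoid σ) : ℝ :=
  (FreeAlgebra.equivMonoidAlgebraFreeMonoid p).coeff u

/-- The set of words occurring in `p`. -/
noncomputable def words (p : FreeAlgebra ℝ σ) : Finset (FreeMonoid σ) :=
  (FreeAlgebra.equivMonoidAlgebraFreeMonoid p).coeff.support

theorem eq_sum_words (p : FreeAlgebra ℝ σ) :
    p = ∑ u ∈ words p, wordCoeff p u • (u.toList.map (FreeAlgebra.ι ℝ)).prod := by
  have h : FreeAlgebra.equivMonoidAlgebraFreeMonoid.symm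
      (FreeAlgebra.equivMonoidAlgebraFreeMonoid p) = p :=
    AlgEquiv.symm_apply_apply _ p
  conv_lhs => rw [← h]
  change MonoidAlgebra.lift ℝ _ (FreeMonoid σ) (FreeMonoid.lift (FreeAlgebra.ι ℝ)) _ = _
  rw [MonoidAlgebra.lift_apply]
  simp only [FreeMonoid.lift_apply]
  rfl

theorem lift_eq_sum_words {A : Type*} [Ring A] [Algebra ℝ A] (X : σ → A) (p : FreeAlgebra ℝ σ) :
    FreeAlgebra.lift ℝ X p = ∑ u ∈ words p, wordCoeff p u • (u.toList.map X).prod := by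
  conv_lhs => rw [eq_sum_words p]
  simp [map_sum, map_list_prod, Function.comp_def]

theorem equiv_word (u : List σ) :
    FreeAlgebra.equivMonoidAlgebraFreeMonoid ((u.map (FreeAlgebra.ι ℝ)).prod)
      = MonoidAlgebra.single (FreeMonoid.ofList u) (1 : ℝ) := by
  induction u with
  | nil => simp [MonoidAlgebra.one_def]
  | cons x u ih =>
    rw [List.map_cons, List.prod_cons, map_mul, ih]
    have : FreeAlgebra.equivMonoidAlgebraFreeMonoid (FreeAlgebra.ι ℝ x)
        = MonoidAlgebra.single (FreeMonoid.of x) (1 : ℝ) := by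
      simp [FreeAlgebra.equivMonoidAlgebraFreeMonoid]
    rw [this, MonoidAlgebra.single_mul_single, one_mul]
    rfl

/-- The reversal of a word combined with the map `τ` on letters. -/
def reverseMap (τ : σ → σ) (u : List σ) : List σ := (u.map τ).reverse

theorem reverseMap_reverseMap {τ : σ → σ} (hτ : Function.Involutive τ) (u : List σ) :
    reverseMap τ (reverseMap τ u) = u := by
  simp [reverseMap, List.map_reverse, hτ.comp_self]

theorem star_lift_word (τ : σ → σ) (u : List σ) :
    star (FreeAlgebra.lift ℝ (fun s => FreeAlgebra.ι ℝ (τ s)) (u.map (FreeAlgebra.ι ℝ)).prod)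
      = ((reverseMap τ u).map (FreeAlgebra.ι ℝ)).prod := by
  induction u with
  | nil => simp [reverseMap]
  | cons x u ih =>
    rw [List.map_cons, List.prod_cons, map_mul, star_mul, ih]
    simp [reverseMap]

theorem star_smul_freeAlgebra (r : ℝ) (p : FreeAlgebra ℝ σ) : star (r • p) = r • star p := by
  rw [Algebra.smul_def, star_mul, FreeAlgebra.star_algebraMap, Algebra.smul_def, Algebra.commutes]

theorem wordCoeff_star_lift {τ : σ → σ} (hτ : Function.Involutive τ) (p : FreeAlgebra ℝ σ)
    (w : List σ) :
    wordCoeff (star (FreeAlgebra.lift ℝ (fun s => FreeAlgebra.ι ℝ (τ s)) p)) (FreeMonoid.ofList w)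
      = wordCoeff p (FreeMonoid.ofList (reverseMap τ w)) := by
  classical
  -- The fresh `q` can be replaced by the expansion without touching the `p` inside `words p` and
  -- `wordCoeff p`.
  have key : ∀ q : FreeAlgebra ℝ σ, q = p →
      wordCoeff (star (FreeAlgebra.lift ℝ (fun s => FreeAlgebra.ι ℝ (τ s)) q))
        (FreeMonoid.ofList w) = wordCoeff q (FreeMonoid.ofList (reverseMap τ w)) := by
    intro q hq
    rw [eq_sum_words p] at hq
    subst hq
    simp only [wordCoeff, map_sum, star_sum, map_smul, star_smul_freeAlgebra, star_lift_word,
      equiv_word, MonoidAlgebra.coeff_sum, MonoidAlgebra.coeff_smul, Finsupp.finsetSum_apply,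
      Finsupp.smul_apply, MonoidAlgebra.coeff_single]
    refine Finset.sum_congr rfl fun u _ => ?_
    congr 1
    simp only [Finsupp.single_apply]
    refine if_congr ?_ rfl rfl
    constructor
    · intro h
      have h' : reverseMap τ u.toList = w := h
      rw [← h', reverseMap_reverseMap hτ]
    · intro h
      have h' : u.toList = reverseMap τ w := h
      rw [h', reverseMap_reverseMap hτ]
  exact key p rfl

/-! ### Weighted walks on a labelled cycle -/

section Cycle

variable [DecidableEq σ] {k : ℕ} (τ : σ → σ) (w : Fin (k + 3) → σ)

/-- The matrix of the letter `s` on the cycle with vertices `Fin (k + 3)`, in which the edge from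
`a` to `a + 1` carries the letter `w a` and the weight `c a`, and the reversed edge the letter
`τ (w a)` and the same weight. -/
def cycleMatrix (c : Fin (k + 3) → ℝ) (s : σ) : Matrix (Fin (k + 3)) (Fin (k + 3)) ℝ :=
  Matrix.of fun a b => (if b = a + 1 then (if s = w a then c a else 0) else 0) +
    (if a = b + 1 then (if τ s = w b then c b else 0) else 0)

/-- The total weight of the walks from `j` to `0` reading the word `u`. -/
def walkWeight (c : Fin (k + 3) → ℝ) : List σ → Fin (k + 3) → ℝ
  | [], j => if j = 0 then 1 else 0
  | y :: b, j => (if y = w j then c j else 0) * walkWeight c b (j + 1) +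
      (if τ y = w (j - 1) then c (j - 1) else 0) * walkWeight c b (j - 1)

theorem prod_cycleMatrix_apply (c : Fin (k + 3) → ℝ) (u : List σ) (j : Fin (k + 3)) :
    (u.map (cycleMatrix τ w c)).prod j 0 = walkWeight τ w c u j := by
  induction u generalizing j with
  | nil => simp [walkWeight, Matrix.one_apply]
  | cons y b ih =>
    rw [List.map_cons, List.prod_cons, Matrix.mul_apply]
    simp only [ih, cycleMatrix, Matrix.of_apply, add_mul, Finset.sum_add_distrib, walkWeight,
      ite_mul (j = _), ite_mul (_ = j + 1), zero_mul]
    have h : ∀ x : Fin (k + 3), j = x + 1 ↔ x = j - 1 := fun x => by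
      rw [eq_sub_iff_add_eq, eq_comm]
    simp only [h, Finset.sum_ite_eq', Finset.mem_univ, if_true]

theorem cycleMatrix_star {τ : σ → σ} (hτ : Function.Involutive τ) (w : Fin (k + 3) → σ)
    (c : Fin (k + 3) → ℝ) (s : σ) :
    cycleMatrix τ w c (τ s) = (cycleMatrix τ w c s).transpose := by
  ext a b
  simp only [cycleMatrix, Matrix.of_apply, Matrix.transpose_apply, hτ s]
  rw [add_comm]

/-- The weights `e` on the edge `0`, `f` on the edge `1` and `1` on all other edges. -/
def weights (e f : ℝ) (a : Fin (k + 3)) : ℝ := if a = 0 then e else if a = 1 then f else 1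

theorem cycleMatrix_weights_midpoint (e f : ℝ) :
    (1 / 2 : ℝ) • cycleMatrix τ w (weights e f) + (1 - 1 / 2 : ℝ) •
      cycleMatrix τ w (weights (-e) (-f)) = cycleMatrix τ w (weights 0 0) := by
  funext s
  ext a b
  simp only [cycleMatrix, Pi.add_apply, Pi.smul_apply, Matrix.add_apply, Matrix.smul_apply,
    Matrix.of_apply, smul_eq_mul, weights]
  split_ifs <;> ring

/-- Edges 0 and 1 are exactly those at vertex 1, so a walk ending at 0 crosses them an odd number of
times in total only if it starts at 1. -/
theorem walkWeight_neg (e f : ℝ) (u : List σ) (j : Fin (k + 3)) :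
    walkWeight τ w (weights (-e) (-f)) u j =
      (if j = 1 then -1 else 1) * walkWeight τ w (weights e f) u j := by
  induction u generalizing j with
  | nil =>
    by_cases h : j = 0
    · subst h
      simp [walkWeight]
    · simp [walkWeight, h]
  | cons y b ih =>
    have h0 : j + 1 = 1 ↔ j = 0 := by simp
    have h1 : j - 1 = 0 ↔ j = 1 := sub_eq_zero
    have h2 : ¬ (j = 0 ∧ j = 1) := fun h => by simp [h.1] at h
    have h3 : ¬ (j - 1 = 1 ∧ j = 1) := fun h => by simp [h.2] at h
    simp only [walkWeight, ih, h0, weights, h1]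
    split_ifs <;> first | (exfalso; tauto) | ring

/-! ### Shortest walks with edge 0 cut -/

/-- The distance from `j` to `0` in the cycle without the edge `0`. -/
def distZero (j : Fin (k + 3)) : ℕ := if j = 0 then 0 else k + 3 - j

/-- The length of the walk from `j` to `0` that descends and crosses the edge `0`. -/
def height (j : Fin (k + 3)) : ℕ := if j = 0 then k + 3 else j

theorem distZero_succ {j : Fin (k + 3)} (hj : j ≠ 0) : distZero (j + 1) + 1 = distZero j := by
  have h := Fin.val_add_one (n := k + 2) j
  have hl := j.isLt
  simp only [distZero, if_neg hj]
  by_cases hj' : j = Fin.last (k + 2)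
  · subst hj'
    simp
  · rw [if_neg hj'] at h
    have : j + 1 ≠ 0 := fun h0 => by simp [h0] at h
    rw [if_neg this, h]
    omega

theorem val_sub_one {j : Fin (k + 3)} (hj : j ≠ 0) : ((j - 1 : Fin (k + 3)) : ℕ) + 1 = j := by
  rw [Fin.val_sub_one_of_ne_zero hj]
  have : (j : ℕ) ≠ 0 := fun h => hj (Fin.ext h)
  omega

theorem distZero_pred {j : Fin (k + 3)} (hj : j ≠ 0) (hj1 : j ≠ 1) :
    distZero (j - 1) = distZero j + 1 := by
  have h := val_sub_one hj
  have hl := j.isLt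
  have h1 : j - 1 ≠ 0 := fun h0 => hj1 (sub_eq_zero.1 h0)
  simp only [distZero, if_neg hj, if_neg h1]
  omega

theorem height_succ {j : Fin (k + 3)} (hj : j ≠ 0) : height (j + 1) = height j + 1 := by
  have h := Fin.val_add_one (n := k + 2) j
  simp only [height, if_neg hj]
  by_cases hj' : j = Fin.last (k + 2)
  · subst hj'
    simp
  · rw [if_neg hj'] at h
    have : j + 1 ≠ 0 := fun h0 => by simp [h0] at h
    rw [if_neg this, h]

theorem height_pred {j : Fin (k + 3)} (hj1 : j ≠ 1) : height (j - 1) + 1 = height j := by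
  have h1 : j - 1 ≠ 0 := fun h0 => hj1 (sub_eq_zero.1 h0)
  by_cases hj : j = 0
  · subst hj
    simp [height, Fin.coe_neg_one]
  · simp only [height, if_neg hj, if_neg h1, val_sub_one hj]

theorem walkWeight_eq_zero (f : ℝ) (u : List σ) (j : Fin (k + 3)) (h : u.length < distZero j) :
    walkWeight τ w (weights 0 f) u j = 0 := by
  induction u generalizing j with
  | nil =>
    have : j ≠ 0 := fun h0 => by simp [h0, distZero] at h
    simp [walkWeight, this]
  | cons y b ih =>
    have hj : j ≠ 0 := fun h0 => by simp [h0, distZero] at h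
    rw [List.length_cons] at h
    have hs := distZero_succ hj
    rw [walkWeight, ih (j + 1) (by omega)]
    by_cases hj1 : j = 1
    · simp [hj1, weights]
    · rw [ih (j - 1) (by rw [distZero_pred hj hj1]; omega)]
      simp

/-- With edge 0 cut, only the ascending walk is this short. -/
theorem walkWeight_of_length_eq (u : List σ) (j : Fin (k + 3)) (hj : j ≠ 0)
    (h : u.length = distZero j) :
    walkWeight τ w (weights 0 1) u j = if u = (List.ofFn w).drop j then 1 else 0 := by
  induction u generalizing j with
  | nil =>
    have := j.isLt
    simp only [distZero, if_neg hj, List.length_nil] at h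
    omega
  | cons y b ih =>
    rw [List.length_cons] at h
    have hs := distZero_succ hj
    have h2 : (if τ y = w (j - 1) then weights 0 1 (j - 1) else 0) *
        walkWeight τ w (weights 0 1) b (j - 1) = 0 := by
      by_cases hj1 : j = 1
      · simp [hj1, weights]
      · rw [walkWeight_eq_zero _ _ _ _ _ (by rw [distZero_pred hj hj1]; omega), mul_zero]
    have h1 : walkWeight τ w (weights 0 1) b (j + 1) =
        if b = (List.ofFn w).drop (j + 1) then 1 else 0 := by
      by_cases hl : j = Fin.last (k + 2)
      · subst hl
        have hb : b = [] := by
          have : b.length = 0 := by simpa [distZero] using h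
          exact List.length_eq_zero_iff.1 this
        subst hb
        simp [walkWeight]
      · have hv := Fin.val_add_one (n := k + 2) j
        rw [if_neg hl] at hv
        have hne : j + 1 ≠ 0 := fun h0 => by simp [h0] at hv
        rw [ih (j + 1) hne (by omega), hv]
    have hd : (List.ofFn w).drop j = w j :: (List.ofFn w).drop (j + 1) := by
      rw [List.drop_eq_getElem_cons (by rw [List.length_ofFn]; exact j.isLt), List.getElem_ofFn]
    have hw : weights 0 1 j = (1 : ℝ) := by simp [weights, hj]
    rw [walkWeight, h2, h1, hd, hw]
    simp only [List.cons.injEq]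
    split_ifs <;> simp_all

/-- Edge 1 leads to the dead end 1, at distance `k + 2` from 0; a detour there from `j` and on to 0
takes at least `2 * (k + 2) - distZero j` steps. -/
theorem walkWeight_congr (u : List σ) (j : Fin (k + 3)) (hj : j ≠ 1)
    (h : u.length + distZero j < 2 * (k + 2)) :
    walkWeight τ w (weights 0 1) u j = walkWeight τ w (weights 0 0) u j := by
  have hone : distZero (1 : Fin (k + 3)) = k + 2 := by simp [distZero]
  induction u generalizing j with
  | nil => rfl
  | cons y b ih =>
    rw [List.length_cons] at h
    rw [walkWeight, walkWeight]
    by_cases hj0 : j = 0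
    · subst hj0
      have hm : distZero (0 - 1 : Fin (k + 3)) = 1 := by
        simp [distZero, Fin.coe_neg_one]
      have hne : (0 - 1 : Fin (k + 3)) ≠ 1 := fun h1 => by
        rw [h1, hone] at hm; omega
      have hne0 : (0 - 1 : Fin (k + 3)) ≠ 0 := by simp
      have hz : distZero (0 : Fin (k + 3)) = 0 := by simp [distZero]
      rw [ih _ hne (by omega)]
      simp only [weights, if_neg hne0, if_neg hne]
      simp
    · have hs := distZero_succ hj0
      have hp := distZero_pred hj0 hj
      have hne : j + 1 ≠ 1 := by simpa using hj0
      have hne' : j - 1 ≠ 0 := fun h0 => hj (sub_eq_zero.1 h0)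
      rw [ih _ hne (by omega)]
      congr 1
      · simp [weights, hj0, hj]
      · by_cases h1 : j - 1 = 1
        · rw [h1, hone] at hp
          rw [h1, walkWeight_eq_zero _ _ _ _ _ (by omega),
            walkWeight_eq_zero _ _ _ _ _ (by omega)]
          simp
        · rw [ih _ h1 (by omega)]
          simp [weights, hne', h1]

/-! ### Walks crossing edge 0 exactly once -/

/-- The derivative at `e = 0` of the walk weight for the weights `weights e 1`. -/
def walkDeriv : List σ → Fin (k + 3) → ℝ
  | [], _ => 0
  | y :: b, j =>
    (if y = w j ∧ j = 0 then walkWeight τ w (weights 0 1) b (j + 1) else 0) +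
    (if y = w j then weights 0 1 j else 0) * walkDeriv b (j + 1) +
    ((if τ y = w (j - 1) ∧ j = 1 then walkWeight τ w (weights 0 1) b (j - 1) else 0) +
    (if τ y = w (j - 1) then weights 0 1 (j - 1) else 0) * walkDeriv b (j - 1))

theorem hasDerivAt_ite_weights (P : Prop) [Decidable P] (a : Fin (k + 3)) :
    HasDerivAt (fun e : ℝ => if P then weights e 1 a else 0) (if P ∧ a = 0 then 1 else 0) 0 := by
  by_cases hP : P
  · by_cases ha : a = 0
    · simpa [hP, ha, weights] using hasDerivAt_id' (0 : ℝ)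
    · simpa [hP, ha, weights] using hasDerivAt_const (0 : ℝ) _
  · simpa [hP] using hasDerivAt_const (0 : ℝ) (0 : ℝ)

theorem hasDerivAt_walkWeight (u : List σ) (j : Fin (k + 3)) :
    HasDerivAt (fun e : ℝ => walkWeight τ w (weights e 1) u j) (walkDeriv τ w u j) 0 := by
  induction u generalizing j with
  | nil => exact hasDerivAt_const _ _
  | cons y b ih =>
    have h := ((hasDerivAt_ite_weights (y = w j) j).mul (ih (j + 1))).add
      ((hasDerivAt_ite_weights (τ y = w (j - 1)) (j - 1)).mul (ih (j - 1)))
    refine h.congr_deriv ?_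
    simp only [walkDeriv, sub_eq_zero, ite_mul, one_mul, zero_mul]

theorem walkDeriv_eq_zero (u : List σ) (j : Fin (k + 3)) (h : u.length < height j) :
    walkDeriv τ w u j = 0 := by
  induction u generalizing j with
  | nil => rfl
  | cons y b ih =>
    rw [List.length_cons] at h
    have hone : height (1 : Fin (k + 3)) = 1 := by simp [height]
    have hj1 : j ≠ 1 := fun h1 => by rw [h1, hone] at h; omega
    have hp := height_pred hj1
    rw [walkDeriv, ih (j - 1) (by omega)]
    by_cases hj0 : j = 0
    · subst hj0
      have hz : height (0 : Fin (k + 3)) = k + 3 := by simp [height]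
      rw [walkWeight_eq_zero _ _ _ _ _ (by simp [distZero]; omega)]
      simp [weights]
    · rw [ih (j + 1) (by rw [height_succ hj0]; omega)]
      simp [hj0, hj1]

theorem walkDeriv_of_length_eq (u : List σ) (j : Fin (k + 3)) (hj : j ≠ 0)
    (h : u.length = height j) :
    walkDeriv τ w u j = if u.map τ = ((List.ofFn w).take j).reverse then 1 else 0 := by
  induction u generalizing j with
  | nil =>
    simp only [height, if_neg hj, List.length_nil] at h
    exact absurd (Fin.ext h.symm) hj
  | cons y b ih =>
    rw [List.length_cons] at h
    have hv := val_sub_one hj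
    have ht : ((List.ofFn w).take j).reverse =
        w (j - 1) :: ((List.ofFn w).take (j - 1 : Fin (k + 3))).reverse := by
      have hlt := (j - 1).isLt
      rw [← hv, List.take_succ_eq_append_getElem (by rw [List.length_ofFn]; exact hlt),
        List.getElem_ofFn, List.reverse_append]
      rfl
    rw [walkDeriv, walkDeriv_eq_zero _ _ b (j + 1) (by rw [height_succ hj]; omega), ht]
    by_cases hj1 : j = 1
    · subst hj1
      have hb : b = [] := by
        have : b.length = 0 := by simpa [height] using h
        exact List.length_eq_zero_iff.1 this
      subst hb
      simp [walkWeight, walkDeriv]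
    · have hp := height_pred hj1
      have hne : j - 1 ≠ 0 := fun h0 => hj1 (sub_eq_zero.1 h0)
      rw [ih (j - 1) hne (by omega)]
      have hw : weights 0 1 (j - 1) = (1 : ℝ) := by simp [weights, hne]
      simp only [hw, List.map_cons, List.cons.injEq, hj, hj1]
      split_ifs <;> simp_all

/-- The two terms are the two directions round the cycle; both count when the word is its own
adjoint. -/
theorem walkDeriv_zero_of_length_eq {τ : σ → σ} (hτ : Function.Involutive τ)
    (w : Fin (k + 3) → σ) (u : List σ) (h : u.length = k + 3) :
    walkDeriv τ w u 0 = (if u = List.ofFn w then 1 else 0) +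
      (if u = reverseMap τ (List.ofFn w) then 1 else 0) := by
  have hr : u = reverseMap τ (List.ofFn w) ↔ u.map τ = (List.ofFn w).reverse := by
    rw [reverseMap, ← List.map_reverse]
    constructor <;> intro h
    · rw [h, List.map_map, hτ.comp_self, List.map_id]
    · rw [← h, List.map_map, hτ.comp_self, List.map_id]
  cases u with
  | nil => simp at h
  | cons y b =>
    rw [List.length_cons] at h
    have hm : ((0 - 1 : Fin (k + 3)) : ℕ) = k + 2 := by simp [Fin.coe_neg_one]
    have hne : (0 - 1 : Fin (k + 3)) ≠ 0 := by simp
    have hw : weights 0 1 (0 - 1 : Fin (k + 3)) = (1 : ℝ) := by simp [weights]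
    have hlen : (List.ofFn w).length = k + 3 := by simp
    have hd : List.ofFn w = w 0 :: (List.ofFn w).drop 1 := by
      simp [List.ofFn_succ]
    have ht : (List.ofFn w).reverse = w (0 - 1) :: ((List.ofFn w).take (k + 2)).reverse := by
      have : List.ofFn w = (List.ofFn w).take (k + 2 + 1) := by
        rw [List.take_of_length_le (by simp)]
      conv_lhs => rw [this, List.take_succ_eq_append_getElem (by simp)]
      simp only [List.reverse_append, List.getElem_ofFn, List.reverse_cons, List.reverse_nil,
        List.nil_append, List.cons_append]
      congr 2
      exact Fin.ext hm.symm
    rw [walkDeriv, walkWeight_of_length_eq _ _ _ (0 + 1) (by simp) (by simp [distZero]; omega),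
      walkDeriv_of_length_eq _ _ b (0 - 1) hne (by simp only [height, if_neg hne, hm]; omega), hm,
      hw]
    simp only [hr]
    rw [ht]
    conv_rhs => rw [hd]
    simp only [List.map_cons, List.cons.injEq, zero_add, Fin.val_one, weights]
    split_ifs <;> simp_all

end Cycle

/-! ### The degree bound -/

/-- A symmetric polynomial that is midpoint convex on all matrix tuples compatible with an
involution `τ` of the variables has degree at most two. -/
theorem degree_le_two_of_midpoint_convex {τ : σ → σ} (hτ : Function.Involutive τ)
    (p : FreeAlgebra ℝ σ)
    (hp : star (FreeAlgebra.lift ℝ (fun s => FreeAlgebra.ι ℝ (τ s)) p) = p)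
    (hconv : ∀ n : ℕ, 0 < n → ∀ X Y : σ → Matrix (Fin n) (Fin n) ℝ,
      (∀ s, X (τ s) = (X s).transpose) → (∀ s, Y (τ s) = (Y s).transpose) →
      ((1 / 2 : ℝ) • FreeAlgebra.lift ℝ X p + (1 - 1 / 2 : ℝ) • FreeAlgebra.lift ℝ Y p -
        FreeAlgebra.lift ℝ ((1 / 2 : ℝ) • X + (1 - 1 / 2 : ℝ) • Y) p).PosSemidef) :
    degree p ≤ 2 := by
  classical
  by_contra hdeg
  obtain ⟨v, hv, hvmax⟩ : ∃ v ∈ words p, ∀ u ∈ words p, u.length ≤ v.length := by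
    refine Finset.exists_max_image (words p) (fun u => u.length) ?_
    by_contra hne
    rw [Finset.not_nonempty_iff_eq_empty] at hne
    refine hdeg ?_
    change (words p).sup _ ≤ _
    simp [hne]
  have hv3 : 3 ≤ v.length := by
    by_contra hlt
    refine hdeg (Finset.sup_le fun u hu => ?_)
    have := hvmax u hu
    exact_mod_cast (by omega : u.length ≤ 2)
  obtain ⟨k, hk⟩ := Nat.exists_eq_add_of_le' hv3
  obtain ⟨w, hw⟩ : ∃ w : Fin (k + 3) → σ, List.ofFn w = v.toList := by
    have hlen : v.toList.length = k + 3 := hk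
    rw [← hlen]
    exact ⟨v.toList.get, List.ofFn_get _⟩
  have hentry : ∀ c, FreeAlgebra.lift ℝ (cycleMatrix τ w c) p 0 0 =
      ∑ u ∈ words p, wordCoeff p u * walkWeight τ w c u.toList 0 := fun c => by
    rw [lift_eq_sum_words, Matrix.sum_apply]
    simp [prod_cycleMatrix_apply]
  let q : ℝ → ℝ := fun e => ∑ u ∈ words p, wordCoeff p u * walkWeight τ w (weights e 1) u.toList 0
  have hlen : ∀ u ∈ words p, u.toList.length ≤ k + 3 := fun u hu => hk ▸ hvmax u hu
  have hq0 : q 0 = ∑ u ∈ words p, wordCoeff p u * walkWeight τ w (weights 0 0) u.toList 0 := by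
    refine Finset.sum_congr rfl fun u hu => ?_
    rw [walkWeight_congr _ _ _ _ (by simp)]
    have := hlen u hu
    simp only [distZero, if_pos]
    -- Degree at least three enters here: `k + 3 < 2 * (k + 2)`.
    omega
  have hmin : ∀ e, q 0 ≤ q e := fun e => by
    have h := (hconv (k + 3) (by omega) (cycleMatrix τ w (weights e 1))
      (cycleMatrix τ w (weights (-e) (-1))) (cycleMatrix_star hτ w _)
      (cycleMatrix_star hτ w _)).diag_nonneg (i := 0)
    rw [cycleMatrix_weights_midpoint] at h
    simp only [Matrix.sub_apply, Matrix.add_apply, Matrix.smul_apply, hentry, walkWeight_neg,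
      ← hq0, smul_eq_mul] at h
    simp only [zero_ne_one, if_false, one_mul] at h
    change 0 ≤ 1 / 2 * q e + (1 - 1 / 2) * q e - q 0 at h
    linarith
  have hderiv : HasDerivAt q (∑ u ∈ words p, wordCoeff p u * walkDeriv τ w u.toList 0) 0 :=
    HasDerivAt.fun_sum fun u _ => (hasDerivAt_walkWeight τ w u.toList 0).const_mul _
  have hzero := (IsLocalMin.hasDerivAt_eq_zero (Filter.Eventually.of_forall hmin) hderiv)
  have hsplit : ∀ u ∈ words p, wordCoeff p u * walkDeriv τ w u.toList 0 =
      (if u = v then wordCoeff p u else 0) +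
        (if u = FreeMonoid.ofList (reverseMap τ v.toList) then wordCoeff p u else 0) := by
    intro u hu
    have h1 : u = v ↔ u.toList = v.toList := Iff.rfl
    have h2 : u = FreeMonoid.ofList (reverseMap τ v.toList) ↔
        u.toList = reverseMap τ v.toList := Iff.rfl
    simp only [h1, h2]
    rcases (hlen u hu).lt_or_eq with hlt | heq
    · rw [walkDeriv_eq_zero _ _ _ _ (by simpa [height] using hlt)]
      have hvl : v.toList.length = k + 3 := hk
      rw [if_neg fun h => by rw [h] at hlt; omega, if_neg fun h => by
        rw [h, reverseMap, List.length_reverse, List.length_map] at hlt; omega]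
      simp
    · rw [walkDeriv_zero_of_length_eq hτ _ _ heq, hw, mul_add]
      simp
  have hsym : wordCoeff p (FreeMonoid.ofList (reverseMap τ v.toList)) = wordCoeff p v := by
    rw [← wordCoeff_star_lift hτ, hp]
    rfl
  have hv0 : wordCoeff p v ≠ 0 := Finsupp.mem_support_iff.1 hv
  have hmem : FreeMonoid.ofList (reverseMap τ v.toList) ∈ words p :=
    Finsupp.mem_support_iff.2 (by rw [← hsym] at hv0; exact hv0)
  rw [Finset.sum_congr rfl hsplit, Finset.sum_add_distrib, Finset.sum_ite_eq', Finset.sum_ite_eq',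
    if_pos hv, if_pos hmem, hsym] at hzero
  exact hv0 (by linarith)

end NCPoly

theorem mainTheorem2 (g : ℕ) :
    (∀ p : FreeAlgebra ℝ (Fin g), star p = p → NCPoly.MatrixConvex p → NCPoly.degree p ≤ 2) ∧
    (∀ p : FreeAlgebra ℝ (Fin g ⊕ Fin g), NCPoly.adjoint p = p → NCPoly.MatrixConvexStar p →
      NCPoly.degree p ≤ 2) := by
  refine ⟨fun p hp hconv => ?_, fun p hp hconv => ?_⟩
  · refine NCPoly.degree_le_two_of_midpoint_convex (τ := id) (fun _ => rfl) p ?_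
      fun n hn X Y hX hY => ?_
    · have : FreeAlgebra.lift ℝ (fun s : Fin g => FreeAlgebra.ι ℝ (id s)) = AlgHom.id ℝ _ := by
        ext
        simp
      rw [this]
      exact hp
    · exact hconv n hn X Y (fun i => (hX i).symm) (fun i => (hY i).symm) (1 / 2) (by norm_num)
        (by norm_num)
  · refine NCPoly.degree_le_two_of_midpoint_convex (τ := Sum.swap) Sum.swap_swap p hp
      fun n hn X Y hX hY => ?_
    have h := hconv n hn (fun i => X (Sum.inl i)) (fun i => Y (Sum.inl i)) (1 / 2) (by norm_num)
      (by norm_num)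
    have key : ∀ Z : Fin g ⊕ Fin g → Matrix (Fin n) (Fin n) ℝ,
        (∀ s, Z s.swap = (Z s).transpose) →
        NCPoly.evalStar (fun i => Z (Sum.inl i)) p = FreeAlgebra.lift ℝ Z p := by
      intro Z hZ
      unfold NCPoly.evalStar
      congr 2
      funext s
      cases s with
      | inl i => rfl
      | inr i => exact (hZ (Sum.inl i)).symm
    have hXY : ∀ s : Fin g ⊕ Fin g, ((1 / 2 : ℝ) • X + (1 - 1 / 2 : ℝ) • Y) s.swap =
        (((1 / 2 : ℝ) • X + (1 - 1 / 2 : ℝ) • Y) s).transpose := fun s => by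
      simp [hX, hY, Matrix.transpose_add, Matrix.transpose_smul]
    rw [key X hX, key Y hY] at h
    have h3 := key _ hXY
    rw [← h3]
    exact h
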